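/- **Setting.** Let $A,B$ be bounded operators on $\ell^2=\ell^2_{[0:\infty)}$ (canonical basis $e_0,e_1,\dots$) with tridiagonal matrices. Write the entries of $zB-A$ as $(zB-A)_{n,n}=\beta_n(z)$, $(zB-A)_{n,n+1}=-\alpha_n^R(z)$, $(zB-A)_{n+1,n}=-\alpha_n^L(z)$, and suppose that none of the polynomials $\beta_n,\alpha_n^L,\alpha_n^R$ (of degree at most one) vanishes identically. Let $\rho(A,B)\subset\overline{\mathbb C}$ be the set of $z\in\mathbb C$ for which $zB-A$ has a bounded inverse, together with $\infty$ if $B$ has a bounded inverse, and let $m(z)=\langle (zB-A)^{-1}e_0,e_0\rangle$ for finite $z\in\rho(A,B)$. Define $q_{-1}=0$, $q_0=1$, $q_1=\beta_0$, $q_{n+1}=\beta_nq_n-\alpha_{n-1}^L\alpha_{n-1}^Rq_{n-1}$ for $n\ge1$, and $$q_n^L=\frac{q_n}{\alpha_0^L\cdots\alpha_{n-1}^L},\qquad q_n^R=\frac{q_n}{\alpha_0^R\cdots\alpha_{n-1}^R}.$$ Let $\Gamma_{ext}\subset\overline{\mathbb C}$ be a domain whose boundary is a rectifiable Jordan curve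 $\Gamma\subset\mathbb C$, oriented such that $\Gamma_{ext}$ lies on its right. Suppose that $\Gamma_{ext}$ contains the roots of all $\alpha_k^L,\alpha_k^R$ (the root being $\infty$ if the degree is $0$) and that $\mathrm{Clos}(\Gamma_{ext})\subset\rho(A,B)$. **Proposition.** Let $x_0\in\Gamma_{ext}$ be finite with $\alpha_n^L(x_0)\alpha_n^R(x_0)\neq0$ for all $n\ge0$, and suppose that there is a factorization of infinite matrices $x_0B-A=UDL$, where $D=\mathrm{diag}(d_0,d_1,\dots)$ with $d_0\ne0$, $U$ is upper bidiagonal with diagonal entries $1$ and $U_{n,n+1}=-u_n^R$, and $L$ is lower bidiagonal with diagonal entries $1$ and $L_{n+1,n}=-u_n^L$ (where $d_n,u_n^L,u_n^R\in\mathbb C$). Put $\mathcal Q_0^L=\mathcal Q_0^R=1$ and, for $n\ge1$, $$\mathcal Q_n^L(x)=q_n^L(x)-u_{n-1}^R\,q_{n-1}^L(x),\qquad \mathcal Q_n^R(x)=q_n^R(x)-u_{n-1}^L\,q_{n-1}^R(x).$$ Consider the functional $$\widetilde{\mathfrak S}(g)=\frac1{2\pi i}\int_\Gamma g(\zeta)\,\frac{m(\zeta)}{x_0-\zeta}\,d\zeta+\Bigl(\frac1{d_0}-m(x_0)\Bigr)g(x_0),$$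 for functions $g$ that are continuous on $\Gamma$ and defined at $x_0$. Then the integral exists for every such $g$, the products $\mathcal Q_j^R\mathcal Q_k^L$ are continuous on $\Gamma$, and $$\widetilde{\mathfrak S}\bigl(\mathcal Q_j^R\,\mathcal Q_k^L\bigr)=0\quad(j\neq k),\qquad d_j\neq0,\qquad \widetilde{\mathfrak S}\bigl(\mathcal Q_j^R\,\mathcal Q_j^L\bigr)=\frac1{d_j}\quad(j\ge0).$$ -/

import Mathlib

open scoped NNReal

noncomputable section

namespace LinearPencil

open Polynomial

/-- The Hilbert space `ℓ²` of square summable complex sequences. -/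
abbrev EllTwo : Type := lp (fun _ : ℕ => ℂ) 2

/-- The canonical vector `e_n`. -/
def basisVec (n : ℕ) : EllTwo := lp.single 2 n (1 : ℂ)

/-- The entry `⟨T e_j, e_i⟩` in row `i` and column `j` of the matrix of `T`. -/
def entry (T : EllTwo →L[ℂ] EllTwo) (i j : ℕ) : ℂ := T (basisVec j) i

/-- The infinite matrix of `T` is tridiagonal. -/
def IsTridiagonal (T : EllTwo →L[ℂ] EllTwo) : Prop :=
  ∀ i j : ℕ, i + 1 < j ∨ j + 1 < i → entry T i j = 0

variable (A B : EllTwo →L[ℂ] EllTwo)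

/-- The diagonal entries `β_n(z)` of `z B - A`. -/
def beta (n : ℕ) : ℂ[X] := C (entry B n n) * X - C (entry A n n)

/-- `- α_n^R(z)` is the entry of `z B - A` in row `n` and column `n + 1`. -/
def alphaR (n : ℕ) : ℂ[X] := -(C (entry B n (n + 1)) * X - C (entry A n (n + 1)))

/-- `- α_n^L(z)` is the entry of `z B - A` in row `n + 1` and column `n`. -/
def alphaL (n : ℕ) : ℂ[X] := -(C (entry B (n + 1) n) * X - C (entry A (n + 1) n))

/-- Bounded tridiagonal pencil `z B - A` for which none of the polynomials
`β_n`, `α_n^L`, `α_n^R` (of degree at most one) vanishes identically. -/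
structure IsTridiagonalPencil : Prop where
  tridiagonal_A : IsTridiagonal A
  tridiagonal_B : IsTridiagonal B
  beta_ne_zero : ∀ n, beta A B n ≠ 0
  alphaL_ne_zero : ∀ n, alphaL A B n ≠ 0
  alphaR_ne_zero : ∀ n, alphaR A B n ≠ 0

/-- The operator `z B - A`. -/
def pencil (z : ℂ) : EllTwo →L[ℂ] EllTwo := z • B - A

/-- The resolvent set `ρ(A, B)`, as a subset of the Riemann sphere: a finite `z` belongs to it
iff `z B - A` has a bounded inverse, and `∞` belongs to it iff `B` has a bounded inverse. -/
def resolventSet : Set (OnePoint ℂ) :=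
  {w | (∃ z : ℂ, w = (z : OnePoint ℂ) ∧ IsUnit (pencil A B z)) ∨
    (w = OnePoint.infty ∧ IsUnit B)}

/-- The `m`-function `m(z) = ⟨(z B - A)⁻¹ e_0, e_0⟩` (used only for `z` in the resolvent set). -/
def mFun (z : ℂ) : ℂ := entry (Ring.inverse (pencil A B z)) 0 0

/-- The denominators `q_n`: `q_{-1} = 0`, `q_0 = 1` and
`q_{n+1} = β_n q_n - α_{n-1}^L α_{n-1}^R q_{n-1}`. -/
def q : ℕ → ℂ[X]
  | 0 => 1
  | 1 => beta A B 0
  | n + 2 => beta A B (n + 1) * q (n + 1) - alphaL A B n * alphaR A B n * q n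

/-- `q_n^L = q_n / (α_0^L ⋯ α_{n-1}^L)`, as a function. -/
def qL (n : ℕ) (x : ℂ) : ℂ := (q A B n).eval x / ∏ k ∈ Finset.range n, (alphaL A B k).eval x

/-- `q_n^R = q_n / (α_0^R ⋯ α_{n-1}^R)`, as a function. -/
def qR (n : ℕ) (x : ℂ) : ℂ := (q A B n).eval x / ∏ k ∈ Finset.range n, (alphaR A B k).eval x

/-- The root in the Riemann sphere of a nonzero polynomial of degree at most one, which is `∞`
for a polynomial of degree zero. -/
def sphereRoot (f : ℂ[X]) : OnePoint ℂ :=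
  if f.coeff 1 = 0 then OnePoint.infty else ((-f.coeff 0 / f.coeff 1 : ℂ) : OnePoint ℂ)

/-- `γ`, restricted to `[0, 1]`, is a rectifiable Jordan curve; by rectifiability it may be
parametrized in a Lipschitz way, for instance proportionally to arc length. -/
structure IsRectifiableJordanCurve (γ : ℝ → ℂ) : Prop where
  lipschitz : ∃ K : ℝ≥0, LipschitzOnWith K γ (Set.Icc 0 1)
  closed : γ 0 = γ 1
  injOn : Set.InjOn γ (Set.Ico 0 1)

/-- The trace of the curve. -/
def trace (γ : ℝ → ℂ) : Set ℂ := γ '' Set.Icc 0 1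

/-- The contour integral of `f` along `γ`. -/
def contourIntegral (γ : ℝ → ℂ) (f : ℂ → ℂ) : ℂ :=
  ∫ t in (0 : ℝ)..1, f (γ t) * deriv γ t

/-- The winding number of `γ` around a point `w` that is not on the trace of `γ`. -/
def windingNumber (γ : ℝ → ℂ) (w : ℂ) : ℂ :=
  (2 * Real.pi * Complex.I)⁻¹ * contourIntegral γ (fun ζ => (ζ - w)⁻¹)

/-- The domain `G` of the Riemann sphere lies to the right of the Jordan curve `γ` that bounds it:
the winding number increases by one from `G` to the other side of `γ`. For a `G` containing `∞`
this says that `γ` is counterclockwise, for a bounded `G` that `γ` is clockwise. -/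
def LiesOnRight (G : Set (OnePoint ℂ)) (γ : ℝ → ℂ) : Prop :=
  ∀ z w : ℂ, (z : OnePoint ℂ) ∈ G → (w : OnePoint ℂ) ∉ closure G →
    windingNumber γ w = windingNumber γ z + 1

/-- The standing assumption on the pencil `z B - A`: `G` is a domain of the Riemann sphere that is
bounded by the Jordan curve `γ` and lies to its right, contains all the roots of the `α_k^L` and
`α_k^R`, and has its closure inside the resolvent set. -/
structure IsAdmissibleDomain (G : Set (OnePoint ℂ)) (γ : ℝ → ℂ) : Prop where
  jordan : IsRectifiableJordanCurve γ
  isOpen : IsOpen G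
  isConnected : IsConnected G
  frontier_eq : frontier G = (fun z : ℂ => (z : OnePoint ℂ)) '' trace γ
  liesOnRight : LiesOnRight G γ
  rootL_mem : ∀ k, sphereRoot (alphaL A B k) ∈ G
  rootR_mem : ∀ k, sphereRoot (alphaR A B k) ∈ G
  closure_subset : closure G ⊆ resolventSet A B

/-- The upper bidiagonal matrix with unit diagonal and superdiagonal `-u_0, -u_1, …`. -/
def upperBidiagonal (u : ℕ → ℂ) : Matrix ℕ ℕ ℂ :=
  fun i j => if i = j then 1 else if j = i + 1 then -u i else 0

/-- The lower bidiagonal matrix with unit diagonal and subdiagonal `-u_0, -u_1, …`. -/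
def lowerBidiagonal (u : ℕ → ℂ) : Matrix ℕ ℕ ℂ :=
  fun i j => if i = j then 1 else if i = j + 1 then -u j else 0

/-- `x₀ B - A = U D L` as a (formal) product of infinite matrices, with `U` unit upper bidiagonal,
`D` diagonal and `L` unit lower bidiagonal; the sum over `k` has at most two nonzero terms. -/
def IsULFactorization (x₀ : ℂ) (d uL uR : ℕ → ℂ) : Prop :=
  ∀ i j : ℕ, entry (pencil A B x₀) i j =
    ∑ᶠ k : ℕ, upperBidiagonal uR i k * d k * lowerBidiagonal uL k j

/-- The Geronimus transform `Q_n^L(x) = q_n^L(x) - u_{n-1}^R q_{n-1}^L(x)`, `Q_0^L = 1`. -/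
def geronimusL (uR : ℕ → ℂ) : ℕ → ℂ → ℂ
  | 0, _ => 1
  | n + 1, x => qL A B (n + 1) x - uR n * qL A B n x

/-- The Geronimus transform `Q_n^R(x) = q_n^R(x) - u_{n-1}^L q_{n-1}^R(x)`, `Q_0^R = 1`. -/
def geronimusR (uL : ℕ → ℂ) : ℕ → ℂ → ℂ
  | 0, _ => 1
  | n + 1, x => qR A B (n + 1) x - uL n * qR A B n x

/-- The functional
`g ↦ (2πi)⁻¹ ∫_Γ g(ζ) m(ζ) / (x₀ - ζ) dζ + (1 / d₀ - m(x₀)) g(x₀)`. -/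
def geronimusFunctional (γ : ℝ → ℂ) (x₀ d₀ : ℂ) (g : ℂ → ℂ) : ℂ :=
  (2 * Real.pi * Complex.I)⁻¹ *
      contourIntegral γ (fun ζ => g ζ * (mFun A B ζ / (x₀ - ζ))) +
    (1 / d₀ - mFun A B x₀) * g x₀

end LinearPencil

end

/-! Let R(z) be the inverse of zB - A. Its rows and columns satisfy the three-term recurrences of
q^L and q^R, up to a unit source at the diagonal. Cancelling the source with a solution P
(`rationalPart`) built by the recurrences alone leaves a homogeneous solution, hence R_{jk} + P_{jk}
= q_j^R q_k^L m (`resolvent_add_rationalPart`). P involves only the β_n, α_n^L, α_n^R, and its poles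
are roots of the α's.

Multiplying by L on the left and U on the right turns q^R, q^L into the Geronimus transforms: on Γ,
Q_j^R Q_k^L m = (LRU)_{jk} + (LPU)_{jk}. The first summand is analytic on the closure of G, the
second off G, and the one living on the side of ∞ vanishes there. Integration against 1/(x₀ - ζ)
therefore returns (LRU)_{jk}(x₀). Since the splitting also holds at x₀, the point mass -m(x₀)
replaces this by -(LPU)_{jk}(x₀), and the functional equals (Q_j^R Q_k^L / d₀ - (LPU)_{jk})(x₀)
(`geronimusFunctional_eq`).

The rest is algebra at x₀: q^R q^L / d₀ - P is a formal inverse of UDL, so L times it times U ought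
to be D⁻¹. Products of infinite matrices need not associate, so this is verified through the
first-order recurrences to which the factorization reduces the three-term ones
(`geronimus_mul_div_sub_dressed_rationalPart`).

Cauchy's formula is obtained by Dixon's argument, which asks of the curve only its winding numbers
on the two sides. -/

noncomputable section

namespace LinearPencil

/-! ### Contour integrals and Cauchy's formula after Dixon. -/

section ContourIntegrals

open MeasureTheory Set Filter Topology Metric
open scoped Interval

/-- A parametric integral of a bounded family of holomorphic functions is holomorphic. -/
theorem differentiableAt_integral_of_bounded {k : ℂ → ℝ → ℂ} {w : ℝ → ℂ}
    (hw : IntervalIntegrable w volume 0 1) {z₀ : ℂ} {R M : ℝ} (hR : 0 < R)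
    (hc : ∀ z ∈ ball z₀ R, ContinuousOn (k z) (Icc 0 1))
    (hd : ∀ t ∈ Icc (0 : ℝ) 1, DifferentiableOn ℂ (fun z => k z t) (ball z₀ R))
    (hb : ∀ z ∈ ball z₀ R, ∀ t ∈ Icc (0 : ℝ) 1, ‖k z t‖ ≤ M) :
    DifferentiableAt ℂ (fun z => ∫ t in (0 : ℝ)..1, k z t * w t) z₀ := by
  have hI : Ι (0 : ℝ) 1 ⊆ Icc 0 1 := by
    rw [uIoc_of_le zero_le_one]; exact Ioc_subset_Icc_self
  have hwm : AEStronglyMeasurable w (volume.restrict (Ι (0 : ℝ) 1)) :=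
    (intervalIntegrable_iff.1 hw).aestronglyMeasurable
  have hkm : ∀ z ∈ ball z₀ R, AEStronglyMeasurable (k z) (volume.restrict (Ι (0 : ℝ) 1)) :=
    fun z hz => ((hc z hz).mono hI).aestronglyMeasurable measurableSet_uIoc
  have hz₀ : z₀ ∈ ball z₀ R := mem_ball_self hR
  have hda : ∀ t ∈ Icc (0 : ℝ) 1, ∀ z ∈ ball z₀ R, DifferentiableAt ℂ (fun z => k z t) z :=
    fun t ht z hz => (hd t ht).differentiableAt (isOpen_ball.mem_nhds hz)
  -- Measurability in t comes from a pointwise limit of difference quotients. The increments R/(n+2)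
  -- are less than R already at n = 0, so they stay in the open ball.
  have hderm : AEStronglyMeasurable (fun t => deriv (fun z => k z t) z₀)
      (volume.restrict (Ι (0 : ℝ) 1)) := by
    have hpos : ∀ n : ℕ, 0 < R / (n + 2) := fun n => by positivity
    have hlim : Tendsto (fun n : ℕ => ((R / (n + 2) : ℝ) : ℂ)) atTop (𝓝[≠] 0) := by
      refine tendsto_nhdsWithin_iff.2 ⟨?_, Eventually.of_forall fun n => ?_⟩
      · have : Tendsto (fun n : ℕ => R / ((n : ℝ) + 2)) atTop (𝓝 0) :=
          tendsto_const_nhds.div_atTop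
            (tendsto_atTop_add_const_right _ _ tendsto_natCast_atTop_atTop)
        have h := (Complex.continuous_ofReal.tendsto 0).comp this
        rwa [Complex.ofReal_zero] at h
      · exact Complex.ofReal_ne_zero.2 (hpos n).ne'
    have hmem : ∀ n : ℕ, z₀ + ((R / (n + 2) : ℝ) : ℂ) ∈ ball z₀ R := fun n => by
      rw [mem_ball, dist_eq_norm, add_sub_cancel_left, Complex.norm_real, Real.norm_eq_abs,
        abs_of_pos (hpos n)]
      exact div_lt_self hR (by linarith [(Nat.cast_nonneg n : (0 : ℝ) ≤ n)])
    refine aestronglyMeasurable_of_tendsto_ae atTop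
      (f := fun (n : ℕ) t => (((R / (n + 2) : ℝ) : ℂ))⁻¹ •
        (k (z₀ + ((R / (n + 2) : ℝ) : ℂ)) t - k z₀ t)) (fun n => ?_) ?_
    · exact ((hkm _ (hmem n)).sub (hkm _ hz₀)).const_smul ((R / (n + 2) : ℝ) : ℂ)⁻¹
    · refine (ae_restrict_iff' measurableSet_uIoc).2 (Eventually.of_forall fun t ht => ?_)
      exact (hasDerivAt_iff_tendsto_slope_zero.1 (hda t (hI ht) z₀ hz₀).hasDerivAt).comp hlim
  refine (intervalIntegral.hasDerivAt_integral_of_dominated_loc_of_deriv_le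
    (F' := fun z t => deriv (fun z => k z t) z * w t) (s := ball z₀ (R / 2))
    (bound := fun t => M / (R / 4) * ‖w t‖)
    (ball_mem_nhds _ (half_pos hR)) ?_ ?_ (hderm.mul hwm) ?_ (hw.norm.const_mul _)
    ?_).2.differentiableAt
  · filter_upwards [ball_mem_nhds z₀ hR] with z hz using (hkm z hz).mul hwm
  · exact hw.continuousOn_mul (by rw [uIcc_of_le zero_le_one]; exact hc _ hz₀)
  -- Cauchy's estimate on the circle of radius R/4 about z, which lies in the ball of radius R
  -- because z is within R/2 of z₀; hence the bound M / (R/4).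
  · refine Eventually.of_forall fun t ht z hz => ?_
    rw [norm_mul]
    refine mul_le_mul_of_nonneg_right ?_ (norm_nonneg _)
    have hsub : closedBall z (R / 4) ⊆ ball z₀ R := fun y hy => by
      rw [mem_closedBall] at hy; rw [mem_ball] at hz ⊢
      linarith [dist_triangle y z z₀]
    refine Complex.norm_deriv_le_of_forall_mem_sphere_norm_le (by positivity) ?_
      fun y hy => hb y (hsub (sphere_subset_closedBall hy)) t (hI ht)
    refine DifferentiableOn.diffContOnCl ?_
    rw [closure_ball _ (by positivity)]
    exact (hd t (hI ht)).mono hsub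
  · exact Eventually.of_forall fun t ht z hz =>
      ((hda t (hI ht) z (ball_subset_ball (by linarith) hz)).hasDerivAt).mul_const _

/-- Symmetry of the difference quotient turns analyticity in the second argument into analyticity in
the first, the one that stays free after integration. -/
theorem dslope_comm (f : ℂ → ℂ) (a b : ℂ) : dslope f a b = dslope f b a := by
  rcases eq_or_ne a b with rfl | h
  · rfl
  · rw [dslope_of_ne _ h.symm, dslope_of_ne _ h, slope_comm]

variable {γ : ℝ → ℂ} {f : ℂ → ℂ}

theorem isCompact_trace (hγ : ContinuousOn γ (Icc 0 1)) : IsCompact (trace γ) :=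
  isCompact_Icc.image_of_continuousOn hγ

theorem mem_trace {t : ℝ} (ht : t ∈ Icc (0 : ℝ) 1) : γ t ∈ trace γ := mem_image_of_mem _ ht

theorem intervalIntegrable_contour (hγ : ContinuousOn γ (Icc 0 1))
    (hγ' : IntervalIntegrable (deriv γ) volume 0 1) (hf : ContinuousOn f (trace γ)) :
    IntervalIntegrable (fun t => f (γ t) * deriv γ t) volume 0 1 :=
  hγ'.continuousOn_mul (by
    rw [uIcc_of_le zero_le_one]; exact hf.comp hγ fun t ht => mem_trace ht)

theorem contourIntegral_congr {g : ℂ → ℂ} (h : ∀ ζ ∈ trace γ, f ζ = g ζ) :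
    contourIntegral γ f = contourIntegral γ g := by
  refine intervalIntegral.integral_congr fun t ht => ?_
  rw [uIcc_of_le zero_le_one] at ht
  simp only [h _ (mem_trace ht)]

theorem contourIntegral_add {g : ℂ → ℂ} (hγ : ContinuousOn γ (Icc 0 1))
    (hγ' : IntervalIntegrable (deriv γ) volume 0 1) (hf : ContinuousOn f (trace γ))
    (hg : ContinuousOn g (trace γ)) :
    contourIntegral γ (fun ζ => f ζ + g ζ) = contourIntegral γ f + contourIntegral γ g := by
  simp only [contourIntegral, add_mul]
  exact intervalIntegral.integral_add (intervalIntegrable_contour hγ hγ' hf)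
    (intervalIntegrable_contour hγ hγ' hg)

theorem contourIntegral_const_mul (c : ℂ) :
    contourIntegral γ (fun ζ => c * f ζ) = c * contourIntegral γ f := by
  simp only [contourIntegral, mul_assoc]
  exact intervalIntegral.integral_const_mul _ _

theorem differentiableAt_cauchyTransform (hγ : ContinuousOn γ (Icc 0 1))
    (hγ' : IntervalIntegrable (deriv γ) volume 0 1) (hf : ContinuousOn f (trace γ))
    {z₀ : ℂ} (hz₀ : z₀ ∉ trace γ) :
    DifferentiableAt ℂ (fun z => contourIntegral γ fun ζ => f ζ * (ζ - z)⁻¹) z₀ := by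
  obtain ⟨C, hC⟩ := (isCompact_trace hγ).exists_bound_of_continuousOn hf
  obtain ⟨R, hR, hball⟩ := Metric.mem_nhds_iff.1
    ((isCompact_trace hγ).isClosed.isOpen_compl.mem_nhds hz₀)
  have hfar : ∀ z ∈ ball z₀ (R / 2), ∀ ζ ∈ trace γ, R / 2 ≤ ‖ζ - z‖ := fun z hz ζ hζ => by
    have h1 : R ≤ dist ζ z₀ := not_lt.1 fun h => hball (mem_ball.2 h) hζ
    rw [mem_ball] at hz
    rw [← dist_eq_norm]
    linarith [dist_triangle ζ z z₀]
  have hne : ∀ z ∈ ball z₀ (R / 2), ∀ ζ ∈ trace γ, ζ - z ≠ 0 := fun z hz ζ hζ =>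
    norm_pos_iff.1 ((half_pos hR).trans_le (hfar z hz ζ hζ))
  refine differentiableAt_integral_of_bounded hγ' (half_pos hR) (M := C * (R / 2)⁻¹) ?_ ?_ ?_
  · intro z hz
    refine ContinuousOn.comp (g := fun ζ => f ζ * (ζ - z)⁻¹) (hf.mul ?_) hγ
      fun t ht => mem_trace ht
    exact (continuousOn_id.sub continuousOn_const).inv₀ fun ζ hζ => hne z hz ζ hζ
  · intro t ht z hz
    refine DifferentiableAt.differentiableWithinAt ?_
    exact ((differentiableAt_id.const_sub (γ t)).inv (hne z hz _ (mem_trace ht))).const_mul _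
  · intro z hz t ht
    rw [norm_mul, norm_inv]
    have h0 := (norm_nonneg _).trans (hC _ (mem_trace ht))
    exact mul_le_mul (hC _ (mem_trace ht))
      (inv_anti₀ (half_pos hR) (hfar z hz _ (mem_trace ht))) (by positivity) h0

theorem tendsto_cauchyTransform (hγ : ContinuousOn γ (Icc 0 1))
    (hγ' : IntervalIntegrable (deriv γ) volume 0 1) (hf : ContinuousOn f (trace γ)) :
    Tendsto (fun z => contourIntegral γ fun ζ => f ζ * (ζ - z)⁻¹) (cocompact ℂ) (𝓝 0) := by
  obtain ⟨C, hC⟩ := (isCompact_trace hγ).exists_bound_of_continuousOn hf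
  obtain ⟨K, hK⟩ := (isCompact_trace hγ).exists_bound_of_continuousOn continuousOn_id
  have hlim : Tendsto (fun z : ℂ => C * (‖z‖ - K)⁻¹ * ∫ t in (0 : ℝ)..1, ‖deriv γ t‖)
      (cocompact ℂ) (𝓝 0) := by
    have : Tendsto (fun z : ℂ => (‖z‖ - K)⁻¹) (cocompact ℂ) (𝓝 0) :=
      tendsto_inv_atTop_zero.comp
        (tendsto_atTop_add_const_right _ (-K) (tendsto_norm_cocompact_atTop (E := ℂ)))
    simpa using (this.const_mul C).mul_const (∫ t in (0 : ℝ)..1, ‖deriv γ t‖)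
  refine squeeze_zero_norm' ?_ hlim
  filter_upwards [(tendsto_norm_cocompact_atTop (E := ℂ)).eventually_gt_atTop K] with z hz
  rw [← intervalIntegral.integral_const_mul]
  refine intervalIntegral.norm_integral_le_of_norm_le zero_le_one
    (Eventually.of_forall fun t ht => ?_) (hγ'.norm.const_mul _)
  have ht' := mem_trace (γ := γ) (Ioc_subset_Icc_self ht)
  rw [norm_mul, norm_mul, norm_inv]
  have h0 := (norm_nonneg _).trans (hC _ ht')
  have h1 : ‖z‖ - K ≤ ‖γ t - z‖ := by
    have := hK _ ht'
    have h2 := norm_sub_norm_le z (γ t)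
    rw [norm_sub_rev] at h2
    simp only [id] at this
    linarith
  gcongr
  exact hC _ ht'

/-- The singularity of the difference quotient is removable, so z₀ may lie on the curve itself.
Uniform bounds suffice: the mean value inequality for γ t near z₀, the size of f divided by the
distance for γ t far from it. -/
theorem differentiableAt_contourIntegral_dslope (hγ : ContinuousOn γ (Icc 0 1))
    (hγ' : IntervalIntegrable (deriv γ) volume 0 1) (hf : ∀ ζ ∈ trace γ, AnalyticAt ℂ f ζ)
    {z₀ : ℂ} (hz₀ : AnalyticAt ℂ f z₀) :
    DifferentiableAt ℂ (fun z => contourIntegral γ (dslope f z)) z₀ := by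
  have hfc : ContinuousOn f (trace γ) := fun ζ hζ => (hf ζ hζ).continuousAt.continuousWithinAt
  obtain ⟨C, hC⟩ := (isCompact_trace hγ).exists_bound_of_continuousOn hfc
  obtain ⟨R, hR, hball⟩ := Metric.mem_nhds_iff.1 ((isOpen_analyticAt ℂ f).mem_nhds hz₀)
  have hsub : closedBall z₀ (R / 2) ⊆ {z | AnalyticAt ℂ f z} :=
    (closedBall_subset_ball (by linarith)).trans hball
  obtain ⟨C₁, hC₁⟩ := (isCompact_closedBall z₀ (R / 2)).exists_bound_of_continuousOn
    (f := f) fun ζ hζ => (hsub hζ).continuousAt.continuousWithinAt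
  obtain ⟨C₂, hC₂⟩ := (isCompact_closedBall z₀ (R / 2)).exists_bound_of_continuousOn
    (f := deriv f) fun ζ hζ => (hsub hζ).deriv.continuousAt.continuousWithinAt
  have hdf : DifferentiableOn ℂ f {z | AnalyticAt ℂ f z} :=
    fun z hz => AnalyticAt.differentiableAt hz |>.differentiableWithinAt
  have hds : ∀ a, AnalyticAt ℂ f a → ∀ b, AnalyticAt ℂ f b → DifferentiableAt ℂ (dslope f a) b :=
    fun a ha b hb => ((Complex.differentiableOn_dslope
      ((isOpen_analyticAt ℂ f).mem_nhds ha)).2 hdf).differentiableAt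
        ((isOpen_analyticAt ℂ f).mem_nhds hb)
  have hin : ball z₀ (R / 4) ⊆ closedBall z₀ (R / 2) :=
    ball_subset_closedBall.trans (closedBall_subset_closedBall (by linarith))
  refine differentiableAt_integral_of_bounded (k := fun z t => dslope f z (γ t)) hγ'
    (R := R / 4) (by positivity) (M := max C₂ ((R / 4)⁻¹ * (C + C₁))) ?_ ?_ ?_
  · intro z hz t ht
    exact (hds z (hsub (hin hz)) _ (hf _ (mem_trace ht))).continuousAt.comp_continuousWithinAt
      (hγ t ht)
  · intro t ht z hz
    simp only [dslope_comm f _ (γ t)]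
    exact (hds _ (hf _ (mem_trace ht)) _ (hsub (hin hz))).differentiableWithinAt
  · intro z hz t ht
    by_cases hclose : γ t ∈ closedBall z₀ (R / 2)
    · refine le_max_of_le_left ?_
      rcases eq_or_ne (γ t) z with h | h
      · rw [h, dslope_same]; exact hC₂ _ (hin hz)
      · rw [dslope_of_ne _ h, slope_def_field, norm_div,
          div_le_iff₀ (norm_pos_iff.2 (sub_ne_zero.2 h))]
        exact (convex_closedBall z₀ (R / 2)).norm_image_sub_le_of_norm_deriv_le
          (fun x hx => (hsub hx).differentiableAt) hC₂ (hin hz) hclose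
    · refine le_max_of_le_right ?_
      have hfar : R / 4 ≤ ‖γ t - z‖ := by
        rw [mem_closedBall, not_le] at hclose
        rw [mem_ball] at hz
        rw [← dist_eq_norm]
        linarith [dist_triangle (γ t) z z₀]
      have h : γ t ≠ z := fun h => by simp [h] at hfar; linarith
      rw [dslope_of_ne _ h, slope_def_field, norm_div, div_eq_inv_mul]
      have h3 : ‖f (γ t) - f z‖ ≤ C + C₁ :=
        (norm_sub_le _ _).trans (add_le_add (hC _ (mem_trace ht)) (hC₁ _ (hin hz)))
      gcongr

theorem contourIntegral_dslope (hγ : ContinuousOn γ (Icc 0 1))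
    (hγ' : IntervalIntegrable (deriv γ) volume 0 1) (hf : ContinuousOn f (trace γ))
    {z : ℂ} (hz : z ∉ trace γ) :
    contourIntegral γ (dslope f z) = contourIntegral γ (fun ζ => f ζ * (ζ - z)⁻¹) -
      2 * Real.pi * Complex.I * windingNumber γ z * f z := by
  have hinv : ContinuousOn (fun ζ : ℂ => (ζ - z)⁻¹) (trace γ) :=
    (continuousOn_id.sub continuousOn_const).inv₀ fun ζ hζ =>
      sub_ne_zero.2 (ne_of_mem_of_not_mem hζ hz)
  have h1 : contourIntegral γ (dslope f z) =
      contourIntegral γ (fun ζ => f ζ * (ζ - z)⁻¹ + -f z * (ζ - z)⁻¹) := by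
    refine contourIntegral_congr fun ζ hζ => ?_
    rw [dslope_of_ne _ (ne_of_mem_of_not_mem hζ hz), slope_def_field]
    ring
  rw [h1, contourIntegral_add (f := fun ζ => f ζ * (ζ - z)⁻¹)
    (g := fun ζ => -f z * (ζ - z)⁻¹) hγ hγ' (hf.mul hinv) (continuousOn_const.mul hinv), contourIntegral_const_mul, windingNumber, mul_inv_cancel_left₀ Complex.two_pi_I_ne_zero]
  ring

/-- **Cauchy's formula**, in the style of Dixon, for a curve with winding numbers `a` and `b`
on two open sets that together with the curve cover the plane. -/
theorem cauchy_formula (hγ : ContinuousOn γ (Icc 0 1))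
    (hγ' : IntervalIntegrable (deriv γ) volume 0 1) {E F : Set ℂ} {a b : ℂ}
    (hF : IsOpen F) (hEγ : Disjoint E (trace γ)) (hFγ : Disjoint F (trace γ))
    (hcov : ∀ z, z ∈ E ∨ z ∈ F ∨ z ∈ trace γ)
    (ha : ∀ z ∈ E, windingNumber γ z = a) (hb : ∀ z ∈ F, windingNumber γ z = b)
    (hf : ∀ z, z ∉ F → AnalyticAt ℂ f z) (hlim : Tendsto f (cocompact ℂ ⊓ 𝓟 E) (𝓝 0)) :
    (∀ z ∈ F, contourIntegral γ (fun ζ => f ζ * (ζ - z)⁻¹) = 0) ∧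
    (∀ z ∈ E, z ∉ F → contourIntegral γ (fun ζ => f ζ * (ζ - z)⁻¹) =
      2 * Real.pi * Complex.I * (a - b) * f z) := by
  classical
  have hfγ : ∀ ζ ∈ trace γ, AnalyticAt ℂ f ζ := fun ζ hζ =>
    hf ζ fun h => hFγ.le_bot ⟨h, hζ⟩
  have hfc : ContinuousOn f (trace γ) := fun ζ hζ => (hfγ ζ hζ).continuousAt.continuousWithinAt
  set I₀ : ℂ → ℂ := fun z => contourIntegral γ fun ζ => f ζ * (ζ - z)⁻¹ with hI₀
  set I₁ : ℂ → ℂ := fun z => contourIntegral γ (dslope f z) + 2 * Real.pi * Complex.I * b * f z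
    with hI₁
  -- The two formulas agree at points of F where f is analytic, because the winding number there is
  -- b. They glue to an entire function that tends to 0 at infinity, hence to 0 by Liouville;
  -- reading this on F and on E gives the two claims.
  set h : ℂ → ℂ := fun z => if z ∈ F then I₀ z else I₁ z with hh
  have hF₀ : ∀ z ∈ F, h z = I₀ z := fun z hz => if_pos hz
  have hV : ∀ z, AnalyticAt ℂ f z → h z = I₁ z := fun z hz => by
    by_cases hzF : z ∈ F
    · rw [hF₀ z hzF, hI₁]
      simp only
      rw [contourIntegral_dslope hγ hγ' hfc fun hm => hFγ.le_bot ⟨hzF, hm⟩, hb z hzF]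
      ring
    · exact if_neg hzF
  have hE₀ : ∀ z ∈ E, z ∉ F → h z = I₀ z - 2 * Real.pi * Complex.I * (a - b) * f z :=
    fun z hz hzF => by
      rw [hV z (hf z hzF), hI₁]
      simp only
      rw [contourIntegral_dslope hγ hγ' hfc fun hm => hEγ.le_bot ⟨hz, hm⟩, ha z hz]
      ring
  have hdiff : Differentiable ℂ h := fun z => by
    by_cases hzF : z ∈ F
    · refine (differentiableAt_cauchyTransform hγ hγ' hfc
        fun hm => hFγ.le_bot ⟨hzF, hm⟩).congr_of_eventuallyEq ?_
      filter_upwards [hF.mem_nhds hzF] with y hy using hF₀ y hy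
    · have hz := hf z hzF
      refine ((differentiableAt_contourIntegral_dslope hγ hγ' hfγ hz).add
        (hz.differentiableAt.const_mul (2 * Real.pi * Complex.I * b))).congr_of_eventuallyEq ?_
      filter_upwards [hz.eventually_analyticAt] with y hy using hV y hy
  have htend : Tendsto h (cocompact ℂ) (𝓝 0) := by
    have h0 := tendsto_cauchyTransform hγ hγ' hfc
    rw [Metric.tendsto_nhds] at h0 hlim ⊢
    intro ε hε
    -- The added 1 keeps the divisor positive when a = b.
    have hc : 0 < 1 + ‖2 * Real.pi * Complex.I * (a - b)‖ := by positivity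
    have h2 := hlim (ε / 2 / (1 + ‖2 * Real.pi * Complex.I * (a - b)‖)) (by positivity)
    rw [eventually_inf_principal] at h2
    filter_upwards [h0 (ε / 2) (half_pos hε), h2, (isCompact_trace hγ).compl_mem_cocompact]
      with z hz1 hz2 hz3
    rw [dist_zero_right] at hz1 hz2 ⊢
    by_cases hzF : z ∈ F
    · rw [hF₀ z hzF]; exact hz1.trans (half_lt_self hε)
    · have hzE : z ∈ E := (hcov z).resolve_right fun hor => hor.elim hzF hz3
      rw [hE₀ z hzE hzF]
      have h4 : ‖2 * Real.pi * Complex.I * (a - b) * f z‖ < ε / 2 := by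
        have := hz2 hzE
        rw [lt_div_iff₀ hc] at this
        rw [norm_mul]
        nlinarith [norm_nonneg (f z)]
      calc _ ≤ _ := norm_sub_le _ _
        _ < ε / 2 + ε / 2 := add_lt_add hz1 h4
        _ = ε := add_halves ε
  have hzero : ∀ z, h z = 0 := fun z => hdiff.apply_eq_of_tendsto_cocompact z htend
  refine ⟨fun z hz => ?_, fun z hz hzF => ?_⟩
  · exact (hF₀ z hz).symm.trans (hzero z)
  · exact sub_eq_zero.1 ((hE₀ z hz hzF).symm.trans (hzero z))

end ContourIntegrals

/-! ### Bidiagonal products and three-term recurrences. -/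

section Recurrences

open Polynomial Filter Topology

/-- Multiplication of a sequence by a unit bidiagonal matrix with off-diagonal entries `-u`. -/
def bidiagonalMul (u v : ℕ → ℂ) : ℕ → ℂ
  | 0 => v 0
  | n + 1 => v (n + 1) - u n * v n

/-- The product `L X U` with the unit bidiagonal matrices of subdiagonal `-uL` and
superdiagonal `-uR`. -/
def dressed (uL uR : ℕ → ℂ) (X : ℕ → ℕ → ℂ) (j k : ℕ) : ℂ :=
  bidiagonalMul uL (fun i => bidiagonalMul uR (X i) k) j

theorem bidiagonalMul_comm (u v : ℕ → ℂ) (X : ℕ → ℕ → ℂ) (j k : ℕ) :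
    bidiagonalMul u (fun i => bidiagonalMul v (X i) k) j =
      bidiagonalMul v (fun l => bidiagonalMul u (fun i => X i l) j) k := by
  cases j <;> cases k <;> simp only [bidiagonalMul] <;> ring

theorem dressed_add (uL uR : ℕ → ℂ) (X Y : ℕ → ℕ → ℂ) (j k : ℕ) :
    dressed uL uR (fun i l => X i l + Y i l) j k = dressed uL uR X j k + dressed uL uR Y j k := by
  cases j <;> cases k <;> simp only [dressed, bidiagonalMul] <;> ring

theorem dressed_mul (uL uR v w : ℕ → ℂ) (c : ℂ) (j k : ℕ) :
    dressed uL uR (fun i l => v i * w l * c) j k =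
      bidiagonalMul uL v j * bidiagonalMul uR w k * c := by
  cases j <;> cases k <;> simp only [dressed, bidiagonalMul] <;> ring

theorem AnalyticAt.bidiagonalMul {u : ℕ → ℂ} {v : ℂ → ℕ → ℂ} {z : ℂ}
    (hv : ∀ n, AnalyticAt ℂ (fun x => v x n) z) (n : ℕ) :
    AnalyticAt ℂ (fun x => bidiagonalMul u (v x) n) z := by
  cases n with
  | zero => exact hv 0
  | succ n => exact (hv _).sub (analyticAt_const.mul (hv n))

theorem AnalyticAt.dressed {uL uR : ℕ → ℂ} {X : ℂ → ℕ → ℕ → ℂ} {z : ℂ}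
    (hX : ∀ j k, AnalyticAt ℂ (fun x => X x j k) z) (j k : ℕ) :
    AnalyticAt ℂ (fun x => dressed uL uR (X x) j k) z :=
  AnalyticAt.bidiagonalMul (v := fun x i => LinearPencil.bidiagonalMul uR (X x i) k)
    (fun i => AnalyticAt.bidiagonalMul (v := fun x => X x i) (fun l => hX i l) k) j

theorem Tendsto.bidiagonalMul {u : ℕ → ℂ} {v : ℂ → ℕ → ℂ} {l : Filter ℂ}
    (hv : ∀ n, Tendsto (fun x => v x n) l (𝓝 0)) (n : ℕ) :
    Tendsto (fun x => bidiagonalMul u (v x) n) l (𝓝 0) := by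
  cases n with
  | zero => exact hv 0
  | succ n =>
    have := (hv (n + 1)).sub ((hv n).const_mul (u n))
    rwa [mul_zero, sub_zero] at this

theorem Tendsto.dressed {uL uR : ℕ → ℂ} {X : ℂ → ℕ → ℕ → ℂ} {l : Filter ℂ}
    (hX : ∀ j k, Tendsto (fun x => X x j k) l (𝓝 0)) (j k : ℕ) :
    Tendsto (fun x => dressed uL uR (X x) j k) l (𝓝 0) :=
  Tendsto.bidiagonalMul (v := fun x i => LinearPencil.bidiagonalMul uR (X x i) k)
    (fun i => Tendsto.bidiagonalMul (v := fun x => X x i) (fun l => hX i l) k) j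

/-- The inhomogeneous three-term recurrence of a tridiagonal matrix with diagonal `b` and
off-diagonals `-lo`, `-up`. -/
def SolvesRecurrence (b lo up r y : ℕ → ℂ) : Prop :=
  up 0 * y 1 = b 0 * y 0 + r 0 ∧
    ∀ n, up (n + 1) * y (n + 2) = b (n + 1) * y (n + 1) - lo n * y n + r (n + 1)

/-- The solution of the inhomogeneous three-term recurrence with initial value `c`. -/
def recurrenceSolution (c : ℂ) (b lo up r : ℕ → ℂ) : ℕ → ℂ
  | 0 => c
  | 1 => b 0 / up 0 * c + r 0 / up 0
  | n + 2 => b (n + 1) / up (n + 1) * recurrenceSolution c b lo up r (n + 1) -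
      lo n / up (n + 1) * recurrenceSolution c b lo up r n + r (n + 1) / up (n + 1)

section Recurrence

variable {b lo up r : ℕ → ℂ}

theorem solvesRecurrence_recurrenceSolution (c : ℂ) (hup : ∀ n, up n ≠ 0) :
    SolvesRecurrence b lo up r (recurrenceSolution c b lo up r) := by
  refine ⟨?_, fun n => ?_⟩
  · have := hup 0
    simp only [recurrenceSolution]; field_simp
  · have := hup (n + 1)
    rw [recurrenceSolution]; field_simp

theorem SolvesRecurrence.unique {y y' : ℕ → ℂ} (hup : ∀ n, up n ≠ 0)
    (h : SolvesRecurrence b lo up r y) (h' : SolvesRecurrence b lo up r y') (h0 : y 0 = y' 0) :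
    ∀ n, y n = y' n := by
  have key : ∀ n, y n = y' n ∧ y (n + 1) = y' (n + 1) := fun n => by
    induction n with
    | zero =>
      refine ⟨h0, mul_left_cancel₀ (hup 0) ?_⟩
      rw [h.1, h'.1, h0]
    | succ n ih =>
      refine ⟨ih.2, mul_left_cancel₀ (hup (n + 1)) ?_⟩
      rw [h.2, h'.2, ih.1, ih.2]
  exact fun n => (key n).1

theorem SolvesRecurrence.mul_const {y : ℕ → ℂ} (h : SolvesRecurrence b lo up 0 y) (c : ℂ) :
    SolvesRecurrence b lo up 0 (fun n => y n * c) := by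
  refine ⟨?_, fun n => ?_⟩
  · have := h.1
    simp only [Pi.zero_apply] at this ⊢
    linear_combination c * this
  · have := h.2 n
    simp only [Pi.zero_apply] at this ⊢
    linear_combination c * this

/-- Opposite sources cancel. The resolvent supplies `y`, the rational part `y'`, and the homogeneous
sum is then a multiple of q^L or q^R. -/
theorem SolvesRecurrence.add_neg {y y' : ℕ → ℂ} (h : SolvesRecurrence b lo up (-r) y)
    (h' : SolvesRecurrence b lo up r y') :
    SolvesRecurrence b lo up 0 (fun n => y n + y' n) := by
  refine ⟨?_, fun n => ?_⟩
  · have h1 := h.1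
    simp only [Pi.zero_apply, Pi.neg_apply] at h1 ⊢
    linear_combination h1 + h'.1
  · have h1 := h.2 n
    simp only [Pi.zero_apply, Pi.neg_apply] at h1 ⊢
    linear_combination h1 + h'.2 n

/-- A factorization of a tridiagonal matrix into bidiagonal ones reduces the order of the
recurrence. -/
theorem SolvesRecurrence.bidiagonalMul {d u v y : ℕ → ℂ} (h : SolvesRecurrence b lo up r y)
    (hb : ∀ n, b n = d n + u n * v n * d (n + 1)) (hlo : ∀ n, lo n = u n * d (n + 1))
    (hup : ∀ n, up n = v n * d (n + 1)) (n : ℕ) :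
    up n * bidiagonalMul u y (n + 1) = d n * bidiagonalMul u y n + r n := by
  cases n with
  | zero =>
    have := h.1
    simp only [LinearPencil.bidiagonalMul, zero_add]
    rw [mul_sub, this, hb, hup]; ring
  | succ n =>
    have := h.2 n
    simp only [LinearPencil.bidiagonalMul]
    rw [mul_sub, this, hb, hlo, hup]; ring

end Recurrence

/-- Only the `up` coefficients are ever divided by, so only their zeros can produce poles. -/
theorem AnalyticAt.recurrenceSolution {c : ℂ → ℂ} {b lo up : ℂ → ℕ → ℂ} {r : ℕ → ℂ} {z : ℂ}
    (hc : AnalyticAt ℂ c z) (hb : ∀ n, AnalyticAt ℂ (fun x => b x n) z)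
    (hlo : ∀ n, AnalyticAt ℂ (fun x => lo x n) z) (hup : ∀ n, AnalyticAt ℂ (fun x => up x n) z)
    (hne : ∀ n, up z n ≠ 0) (n : ℕ) :
    AnalyticAt ℂ (fun x => recurrenceSolution (c x) (b x) (lo x) (up x) r n) z := by
  induction n using Nat.twoStepInduction with
  | zero => exact hc
  | one =>
    exact (((hb 0).div (hup 0) (hne 0)).mul hc).add (analyticAt_const.div (hup 0) (hne 0))
  | more n ih1 ih2 =>
    exact ((((hb (n + 1)).div (hup (n + 1)) (hne _)).mul ih2).sub
      (((hlo n).div (hup (n + 1)) (hne _)).mul ih1)).add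
        (analyticAt_const.div (hup (n + 1)) (hne _))

theorem tendsto_recurrenceSolution {c : ℂ → ℂ} {b lo up : ℂ → ℕ → ℂ} {r : ℕ → ℂ} {l : Filter ℂ}
    (hc : Tendsto c l (𝓝 0)) (hb : ∀ n, ∃ a, Tendsto (fun x => b x n / up x n) l (𝓝 a))
    (hlo : ∀ n, ∃ a, Tendsto (fun x => lo x n / up x (n + 1)) l (𝓝 a))
    (hup : ∀ n, Tendsto (fun x => r n / up x n) l (𝓝 0)) (n : ℕ) :
    Tendsto (fun x => recurrenceSolution (c x) (b x) (lo x) (up x) r n) l (𝓝 0) := by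
  induction n using Nat.twoStepInduction with
  | zero => exact hc
  | one =>
    obtain ⟨a, ha⟩ := hb 0
    have := (ha.mul hc).add (hup 0)
    rwa [mul_zero, zero_add] at this
  | more n ih1 ih2 =>
    obtain ⟨a, ha⟩ := hb (n + 1)
    obtain ⟨a', ha'⟩ := hlo n
    have := ((ha.mul ih2).sub (ha'.mul ih1)).add (hup (n + 1))
    rwa [mul_zero, mul_zero, sub_zero, zero_add] at this

theorem tendsto_linear_div_linear (a b : ℂ) {c : ℂ} (d : ℂ) (hc : c ≠ 0) :
    Tendsto (fun z : ℂ => (a * z + b) / (c * z + d)) (cocompact ℂ) (𝓝 (a / c)) := by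
  have hi : Tendsto (fun z : ℂ => z⁻¹) (cocompact ℂ) (𝓝 0) := by
    rw [← Metric.cobounded_eq_cocompact]; exact tendsto_inv₀_cobounded
  have h1 : Tendsto (fun z : ℂ => (a + b * z⁻¹) / (c + d * z⁻¹)) (cocompact ℂ) (𝓝 (a / c)) := by
    have := ((hi.const_mul b).const_add a).div ((hi.const_mul d).const_add c) (by simpa using hc)
    rwa [mul_zero, mul_zero, add_zero, add_zero] at this
  refine h1.congr' ?_
  filter_upwards [isCompact_singleton.compl_mem_cocompact] with z (hz : z ≠ 0)
  rw [← mul_div_mul_right (a + b * z⁻¹) (c + d * z⁻¹) hz]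
  congr 1 <;> field_simp

/-! ### The rational part and the algebra of the factorization. -/

section Pencil

variable (A B : EllTwo →L[ℂ] EllTwo)

/-- The function of the second kind belonging to `q_k^L`. -/
def secondKind (z : ℂ) : ℕ → ℂ :=
  recurrenceSolution 0 (fun n => (beta A B n).eval z) (fun n => (alphaR A B n).eval z)
    (fun n => (alphaL A B n).eval z) (Pi.single 0 1)

/-- The formal inverse of `A - z B` with first row of the second kind; its entries are rational
with poles at the roots of the `α_k^L` and `α_k^R` only. -/
def rationalPart (z : ℂ) (j k : ℕ) : ℂ :=
  recurrenceSolution (secondKind A B z k) (fun n => (beta A B n).eval z)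
    (fun n => (alphaL A B n).eval z) (fun n => (alphaR A B n).eval z) (Pi.single k 1) j

variable {A B} {z : ℂ}

/-- This says that q^L, as a row vector, is annihilated by zB - A; dually, q^R is a column vector
annihilated by it. -/
theorem solvesRecurrence_qL (hL : ∀ n, (alphaL A B n).eval z ≠ 0) :
    SolvesRecurrence (fun n => (beta A B n).eval z) (fun n => (alphaR A B n).eval z)
      (fun n => (alphaL A B n).eval z) 0 (fun n => qL A B n z) := by
  refine ⟨?_, fun n => ?_⟩
  · have := hL 0
    simp [qL, q]; field_simp
  · have h1 := hL (n + 1)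
    have h2 := hL n
    have h3 : ∏ k ∈ Finset.range n, (alphaL A B k).eval z ≠ 0 :=
      Finset.prod_ne_zero_iff.2 fun k _ => hL k
    simp only [qL, q, Finset.prod_range_succ, eval_sub, eval_mul, Pi.zero_apply]
    field_simp
    ring

theorem solvesRecurrence_qR (hR : ∀ n, (alphaR A B n).eval z ≠ 0) :
    SolvesRecurrence (fun n => (beta A B n).eval z) (fun n => (alphaL A B n).eval z)
      (fun n => (alphaR A B n).eval z) 0 (fun n => qR A B n z) := by
  refine ⟨?_, fun n => ?_⟩
  · have := hR 0
    simp [qR, q]; field_simp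
  · have h1 := hR (n + 1)
    have h2 := hR n
    have h3 : ∏ k ∈ Finset.range n, (alphaR A B k).eval z ≠ 0 :=
      Finset.prod_ne_zero_iff.2 fun k _ => hR k
    simp only [qR, q, Finset.prod_range_succ, eval_sub, eval_mul, Pi.zero_apply]
    field_simp
    ring

theorem geronimusL_eq (u : ℕ → ℂ) (n : ℕ) (x : ℂ) :
    geronimusL A B u n x = bidiagonalMul u (fun k => qL A B k x) n := by
  cases n <;> simp [geronimusL, bidiagonalMul, qL, q]

theorem geronimusR_eq (u : ℕ → ℂ) (n : ℕ) (x : ℂ) :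
    geronimusR A B u n x = bidiagonalMul u (fun k => qR A B k x) n := by
  cases n <;> simp [geronimusR, bidiagonalMul, qR, q]

theorem analyticAt_eval (p : ℂ[X]) (z : ℂ) : AnalyticAt ℂ (fun x => p.eval x) z :=
  p.differentiable.analyticAt z

theorem analyticAt_rationalPart (hL : ∀ n, (alphaL A B n).eval z ≠ 0)
    (hR : ∀ n, (alphaR A B n).eval z ≠ 0) (j k : ℕ) :
    AnalyticAt ℂ (fun x => rationalPart A B x j k) z :=
  AnalyticAt.recurrenceSolution
    (AnalyticAt.recurrenceSolution analyticAt_const (fun _ => analyticAt_eval _ _)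
      (fun _ => analyticAt_eval _ _) (fun _ => analyticAt_eval _ _) hL k)
    (fun _ => analyticAt_eval _ _) (fun _ => analyticAt_eval _ _)
    (fun _ => analyticAt_eval _ _) hR j

/-- When every α has degree exactly one, the coefficients of the recurrences have finite limits at
infinity while the sources and the initial value tend to 0. -/
theorem tendsto_rationalPart (hL : ∀ n, (alphaL A B n).coeff 1 ≠ 0)
    (hR : ∀ n, (alphaR A B n).coeff 1 ≠ 0) (j k : ℕ) :
    Tendsto (fun x => rationalPart A B x j k) (cocompact ℂ) (𝓝 0) := by
  have key : ∀ p p' : ℂ[X], p.natDegree ≤ 1 → p'.natDegree ≤ 1 → p'.coeff 1 ≠ 0 →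
      Tendsto (fun x => p.eval x / p'.eval x) (cocompact ℂ) (𝓝 (p.coeff 1 / p'.coeff 1)) := by
    intro p p' hp hp' h
    have he : ∀ p : ℂ[X], p.natDegree ≤ 1 → ∀ x, p.eval x = p.coeff 1 * x + p.coeff 0 := by
      intro p hp x
      conv_lhs => rw [eq_X_add_C_of_natDegree_le_one hp]
      simp
    simp only [he p hp, he p' hp']
    exact tendsto_linear_div_linear _ _ _ h
  have hlin : ∀ a b : ℂ, (C a * X - C b).natDegree ≤ 1 := fun a b => by compute_degree
  have hβ : ∀ n, (beta A B n).natDegree ≤ 1 := fun n => hlin _ _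
  have hLd : ∀ n, (alphaL A B n).natDegree ≤ 1 := fun n => by
    rw [alphaL, natDegree_neg]; exact hlin _ _
  have hRd : ∀ n, (alphaR A B n).natDegree ≤ 1 := fun n => by
    rw [alphaR, natDegree_neg]; exact hlin _ _
  have hr : ∀ (c : ℂ) (p' : ℂ[X]), p'.natDegree ≤ 1 → p'.coeff 1 ≠ 0 →
      Tendsto (fun x => c / p'.eval x) (cocompact ℂ) (𝓝 0) := by
    intro c p' hp' h
    have := key (C c) p' (by simp) hp' h
    simpa [coeff_C] using this
  exact tendsto_recurrenceSolution
    (tendsto_recurrenceSolution tendsto_const_nhds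
      (fun n => ⟨_, key _ _ (hβ n) (hLd n) (hL n)⟩)
      (fun n => ⟨_, key _ _ (hRd n) (hLd (n + 1)) (hL _)⟩)
      (fun n => hr _ _ (hLd n) (hL n)) k)
    (fun n => ⟨_, key _ _ (hβ n) (hRd n) (hR n)⟩)
    (fun n => ⟨_, key _ _ (hLd n) (hRd (n + 1)) (hR _)⟩)
    (fun n => hr _ _ (hRd n) (hR n)) j

/-- The Geronimus transforms diagonalize the formal inverse of `A - x₀ B` up to a rank one
term. -/
theorem geronimus_mul_div_sub_dressed_rationalPart {d uL uR : ℕ → ℂ}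
    (hL : ∀ n, (alphaL A B n).eval z ≠ 0) (hR : ∀ n, (alphaR A B n).eval z ≠ 0)
    (hβ : ∀ n, (beta A B n).eval z = d n + uR n * uL n * d (n + 1))
    (hdL : ∀ n, (alphaL A B n).eval z = uL n * d (n + 1))
    (hdR : ∀ n, (alphaR A B n).eval z = uR n * d (n + 1))
    (hd : ∀ n, d n ≠ 0) (j k : ℕ) :
    geronimusR A B uL j z * geronimusL A B uR k z / d 0 -
      dressed uL uR (rationalPart A B z) j k = if j = k then 1 / d j else 0 := by
  have hβ' : ∀ n, (beta A B n).eval z = d n + uL n * uR n * d (n + 1) := fun n => by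
    rw [hβ, mul_comm (uR n)]
  set QR := bidiagonalMul uL fun k => qR A B k z with hQR
  set QL := bidiagonalMul uR fun k => qL A B k z with hQL
  have rR : ∀ n, (alphaR A B n).eval z * QR (n + 1) = d n * QR n := fun n => by
    simpa using (solvesRecurrence_qR hR).bidiagonalMul hβ' hdL hdR n
  have rL : ∀ n, (alphaL A B n).eval z * QL (n + 1) = d n * QL n := fun n => by
    simpa using (solvesRecurrence_qL hL).bidiagonalMul hβ hdR hdL n
  have q0 : QR 0 = 1 := by simp [hQR, bidiagonalMul, qR, q]
  have q0' : QL 0 = 1 := by simp [hQL, bidiagonalMul, qL, q]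
  have rS := (solvesRecurrence_recurrenceSolution (r := Pi.single 0 1)
    (b := fun n => (beta A B n).eval z) (lo := fun n => (alphaR A B n).eval z) 0
      hL).bidiagonalMul hβ hdR hdL
  -- The first row: at k = 0 only 1 / d₀ remains. The unit source of the second-kind function
  -- cancels d₀ · (1 / d₀) at k = 1, and the first-order recurrence propagates 0 from there.
  have hrow : ∀ k, QL k / d 0 - bidiagonalMul uR (secondKind A B z) k =
      if 0 = k then 1 / d 0 else 0 := fun k => by
    have h0 := hd 0
    cases k with
    | zero => simp [q0', bidiagonalMul, secondKind, recurrenceSolution]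
    | succ k =>
      rw [if_neg (Nat.succ_ne_zero k).symm]
      induction k with
      | zero =>
        refine mul_left_cancel₀ (hL 0) ?_
        have h1 := rS 0
        have h2 := rL 0
        rw [secondKind, mul_sub, h1, mul_div_assoc', h2, q0']
        simp [bidiagonalMul, recurrenceSolution, h0]
      | succ k ih =>
        refine mul_left_cancel₀ (hL (k + 1)) ?_
        have h1 := rS (k + 1)
        have h2 := rL (k + 1)
        rw [secondKind] at ih ⊢
        rw [mul_sub, h1, mul_div_assoc', h2]
        simp only [ne_eq, Nat.succ_ne_zero, not_false_eq_true, Pi.single_eq_of_ne]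
        linear_combination d (k + 1) * ih
  have hcol : ∀ k n, (alphaR A B n).eval z *
      bidiagonalMul uL (fun i => rationalPart A B z i k) (n + 1) =
      d n * bidiagonalMul uL (fun i => rationalPart A B z i k) n + (if n = k then 1 else 0) :=
    fun k n => by
      have := (solvesRecurrence_recurrenceSolution (r := Pi.single k 1)
        (b := fun n => (beta A B n).eval z) (lo := fun n => (alphaL A B n).eval z)
        (secondKind A B z k) hR).bidiagonalMul hβ' hdL hdR n
      rw [Pi.single_apply] at this
      exact this
  -- Applying L first makes the column recurrence `hcol` available; the induction then runs down the
  -- rows, starting from `hrow`.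
  rw [geronimusR_eq, geronimusL_eq, ← hQR, ← hQL, dressed, bidiagonalMul_comm]
  induction j with
  | zero =>
    rw [q0, one_mul]
    exact hrow k
  | succ j ih =>
    refine mul_left_cancel₀ (hR j) ?_
    have hT : (alphaR A B j).eval z * bidiagonalMul uR
        (fun l => bidiagonalMul uL (fun i => rationalPart A B z i l) (j + 1)) k =
        d j * bidiagonalMul uR
          (fun l => bidiagonalMul uL (fun i => rationalPart A B z i l) j) k +
        bidiagonalMul uR (fun l => if j = l then 1 else 0) k := by
      cases k with
      | zero => exact hcol 0 j
      | succ k =>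
        have h1 := hcol (k + 1) j
        have h2 := hcol k j
        simp only [show ∀ v, bidiagonalMul uR v (k + 1) = v (k + 1) - uR k * v k from fun _ => rfl]
        linear_combination h1 - uR k * h2
    have hQ : (alphaR A B j).eval z * (QR (j + 1) * QL k / d 0) = d j * (QR j * QL k / d 0) := by
      linear_combination (QL k / d 0) * rR j
    rw [mul_sub, hT, hQ]
    have hdj := hd j
    have : d j * (if j = k then 1 / d j else 0) = if j = k then 1 else 0 := by
      split_ifs <;> simp [hdj]
    have hmain : ∀ S : ℂ, d j * (QR j * QL k / d 0) - (d j * bidiagonalMul uR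
          (fun l => bidiagonalMul uL (fun i => rationalPart A B z i l) j) k + S) =
        (if j = k then 1 else 0) - S := fun S => by
      linear_combination d j * ih + this
    rw [hmain]
    -- Only the superdiagonal correction of U is left, u_j^R when k = j + 1 and 0 otherwise; it
    -- matches α_j^R / d_{j+1} = u_j^R.
    cases k with
    | zero => simp [bidiagonalMul]
    | succ k =>
      rw [bidiagonalMul]
      by_cases hjk : j = k
      · subst hjk
        have := hd (j + 1)
        simp [hdR, this]
      · simp [hjk]

end Pencil

end Recurrences

/-! ### Resolvent entries as solutions of the recurrences. -/

section Operators

open Polynomial Filter Topology Set MeasureTheory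

/-- The matrix entry as a continuous linear functional of the operator. -/
def entryCLM (i j : ℕ) : (EllTwo →L[ℂ] EllTwo) →L[ℂ] ℂ :=
  (lp.evalCLM ℂ (fun _ : ℕ => ℂ) 2 i).comp (ContinuousLinearMap.apply ℂ EllTwo (basisVec j))

theorem entryCLM_apply (T : EllTwo →L[ℂ] EllTwo) (i j : ℕ) : entryCLM i j T = entry T i j := rfl

theorem entry_one (i j : ℕ) : entry 1 i j = if i = j then 1 else 0 := by
  simp only [entry, basisVec, one_apply_eq_self, lp.single_apply, Pi.single_apply]

theorem hasSum_entry_mul (S T : EllTwo →L[ℂ] EllTwo) (i k : ℕ) :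
    HasSum (fun j => entry S i j * entry T j k) (entry (S * T) i k) := by
  have h := (lp.hasSum_single (p := 2) ENNReal.ofNat_ne_top (T (basisVec k))).mapL
    ((lp.evalCLM ℂ (fun _ : ℕ => ℂ) 2 i).comp S)
  refine h.congr_fun fun j => ?_
  have hj : lp.single 2 j (T (basisVec k) j) = entry T j k • basisVec j := by
    have := lp.single_smul (E := fun _ : ℕ => ℂ) 2 j (entry T j k) (1 : ℂ)
    rw [smul_eq_mul, mul_one] at this
    exact this
  rw [hj, map_smul, smul_eq_mul, mul_comm]
  rfl

section Operator

variable {A B : EllTwo →L[ℂ] EllTwo} {z : ℂ}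

theorem entry_pencil (i j : ℕ) : entry (pencil A B z) i j = z * entry B i j - entry A i j := rfl

theorem beta_eval (n : ℕ) : (beta A B n).eval z = entry (pencil A B z) n n := by
  simp only [beta, entry_pencil, eval_sub, eval_mul, eval_C, eval_X]; ring

theorem alphaR_eval (n : ℕ) : (alphaR A B n).eval z = -entry (pencil A B z) n (n + 1) := by
  simp only [alphaR, entry_pencil, eval_neg, eval_sub, eval_mul, eval_C, eval_X]; ring

theorem alphaL_eval (n : ℕ) : (alphaL A B n).eval z = -entry (pencil A B z) (n + 1) n := by
  simp only [alphaL, entry_pencil, eval_neg, eval_sub, eval_mul, eval_C, eval_X]; ring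

theorem IsTridiagonalPencil.entry_pencil_eq_zero (h : IsTridiagonalPencil A B) {i j : ℕ}
    (hij : i + 1 < j ∨ j + 1 < i) : entry (pencil A B z) i j = 0 := by
  rw [entry_pencil, h.tridiagonal_A i j hij, h.tridiagonal_B i j hij]; simp

/-- Row i of R(z)(zB - A) = 1, where tridiagonality cuts the series to at most three terms. The
identity entry moves to the other side, hence the negative source. -/
theorem solvesRecurrence_resolvent_row (h : IsTridiagonalPencil A B)
    (hz : IsUnit (pencil A B z)) (i : ℕ) :
    SolvesRecurrence (fun n => (beta A B n).eval z) (fun n => (alphaR A B n).eval z)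
      (fun n => (alphaL A B n).eval z) (-Pi.single i 1)
      (fun k => entry (Ring.inverse (pencil A B z)) i k) := by
  have key := hasSum_entry_mul (Ring.inverse (pencil A B z)) (pencil A B z) i
  simp only [Ring.inverse_mul_cancel _ hz, entry_one] at key
  refine ⟨?_, fun n => ?_⟩
  · have h0 := (key 0).unique (hasSum_sum_of_ne_finset_zero (s := {0, 1}) fun j hj => by
      simp only [Finset.mem_insert, Finset.mem_singleton, not_or] at hj
      rw [h.entry_pencil_eq_zero (by omega), mul_zero])
    rw [Finset.sum_pair (by simp)] at h0
    simp only [beta_eval, alphaL_eval, Pi.neg_apply, Pi.single_apply, zero_add, @eq_comm _ 0 i]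
    linear_combination h0
  · have h0 := (key (n + 1)).unique
      (hasSum_sum_of_ne_finset_zero (s := {n, n + 1, n + 2}) fun j hj => by
        simp only [Finset.mem_insert, Finset.mem_singleton, not_or] at hj
        rw [h.entry_pencil_eq_zero (by omega), mul_zero])
    rw [Finset.sum_insert (by simp), Finset.sum_pair (by simp)] at h0
    simp only [beta_eval, alphaL_eval, alphaR_eval, Pi.neg_apply, Pi.single_apply,
      @eq_comm _ (n + 1) i]
    linear_combination h0

theorem solvesRecurrence_resolvent_col (h : IsTridiagonalPencil A B)
    (hz : IsUnit (pencil A B z)) (k : ℕ) :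
    SolvesRecurrence (fun n => (beta A B n).eval z) (fun n => (alphaL A B n).eval z)
      (fun n => (alphaR A B n).eval z) (-Pi.single k 1)
      (fun i => entry (Ring.inverse (pencil A B z)) i k) := by
  have key := fun i => hasSum_entry_mul (pencil A B z) (Ring.inverse (pencil A B z)) i k
  simp only [Ring.mul_inverse_cancel _ hz, entry_one] at key
  refine ⟨?_, fun n => ?_⟩
  · have h0 := (key 0).unique (hasSum_sum_of_ne_finset_zero (s := {0, 1}) fun j hj => by
      simp only [Finset.mem_insert, Finset.mem_singleton, not_or] at hj
      rw [h.entry_pencil_eq_zero (by omega), zero_mul])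
    rw [Finset.sum_pair (by simp)] at h0
    simp only [beta_eval, alphaR_eval, Pi.neg_apply, Pi.single_apply, zero_add]
    linear_combination h0
  · have h0 := (key (n + 1)).unique
      (hasSum_sum_of_ne_finset_zero (s := {n, n + 1, n + 2}) fun j hj => by
        simp only [Finset.mem_insert, Finset.mem_singleton, not_or] at hj
        rw [h.entry_pencil_eq_zero (by omega), zero_mul])
    rw [Finset.sum_insert (by simp), Finset.sum_pair (by simp)] at h0
    simp only [beta_eval, alphaL_eval, alphaR_eval, Pi.neg_apply, Pi.single_apply]
    linear_combination h0

/-- The resolvent differs from the rank one matrix `m q^R q^L` by a rational matrix. -/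
theorem resolvent_add_rationalPart (h : IsTridiagonalPencil A B) (hz : IsUnit (pencil A B z))
    (hL : ∀ n, (alphaL A B n).eval z ≠ 0) (hR : ∀ n, (alphaR A B n).eval z ≠ 0) (j k : ℕ) :
    entry (Ring.inverse (pencil A B z)) j k + rationalPart A B z j k =
      qR A B j z * qL A B k z * mFun A B z := by
  -- The second-kind function starts at 0, so this homogeneous sum starts at m(z). The first row
  -- then supplies the initial value for each column.
  have hrow : ∀ k, entry (Ring.inverse (pencil A B z)) 0 k + secondKind A B z k =
      qL A B k z * mFun A B z :=
    ((solvesRecurrence_resolvent_row h hz 0).add_neg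
      (solvesRecurrence_recurrenceSolution 0 hL)).unique hL
        ((solvesRecurrence_qL hL).mul_const _)
        (by simp [secondKind, recurrenceSolution, qL, q, mFun])
  rw [mul_assoc]
  refine ((solvesRecurrence_resolvent_col h hz k).add_neg
    (solvesRecurrence_recurrenceSolution (secondKind A B z k) hR)).unique hR
      ((solvesRecurrence_qR hR).mul_const _) ?_ j
  simpa [recurrenceSolution, qR, q] using hrow k

theorem analyticAt_resolvent (hz : IsUnit (pencil A B z)) (j k : ℕ) :
    AnalyticAt ℂ (fun x => entry (Ring.inverse (pencil A B x)) j k) z := by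
  have h1 : AnalyticAt ℂ (fun x => pencil A B x) z :=
    (analyticAt_id.smul analyticAt_const).sub analyticAt_const
  have h2 : AnalyticAt ℂ Ring.inverse (pencil A B z) := analyticAt_inverse hz.unit
  exact ((entryCLM j k).analyticAt _).comp (h2.comp h1)

/-- For large z the inverse of zB - A is z⁻¹(B - z⁻¹A)⁻¹, and inversion is continuous at B. -/
theorem tendsto_resolvent (hB : IsUnit B) (j k : ℕ) :
    Tendsto (fun x => entry (Ring.inverse (pencil A B x)) j k) (cocompact ℂ) (𝓝 0) := by
  have hi : Tendsto (fun z : ℂ => z⁻¹) (cocompact ℂ) (𝓝 0) := by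
    rw [← Metric.cobounded_eq_cocompact]; exact tendsto_inv₀_cobounded
  have hX : Tendsto (fun z : ℂ => B - z⁻¹ • A) (cocompact ℂ) (𝓝 B) := by
    have := (hi.smul_const A).const_sub B
    rwa [zero_smul, sub_zero] at this
  have hinv : Tendsto (fun z : ℂ => z⁻¹ • Ring.inverse (B - z⁻¹ • A)) (cocompact ℂ) (𝓝 0) := by
    have h := (NormedRing.inverse_continuousAt hB.unit).tendsto.comp hX
    have := hi.smul h
    rwa [zero_smul] at this
  have hlim := ((entryCLM j k).continuous.tendsto 0).comp hinv
  rw [map_zero] at hlim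
  refine hlim.congr' ?_
  filter_upwards [isCompact_singleton.compl_mem_cocompact,
    hX (Units.isOpen.mem_nhds hB)] with z (hz : z ≠ 0) hu
  obtain ⟨u, hu⟩ : IsUnit (B - z⁻¹ • A) := hu
  let v : (EllTwo →L[ℂ] EllTwo)ˣ := ⟨z • (u : EllTwo →L[ℂ] EllTwo),
    z⁻¹ • (↑u⁻¹ : EllTwo →L[ℂ] EllTwo), by rw [smul_mul_smul_comm, mul_inv_cancel₀ hz]; simp,
    by rw [smul_mul_smul_comm, inv_mul_cancel₀ hz]; simp⟩
  have hp : pencil A B z = v := by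
    change _ = z • (u : EllTwo →L[ℂ] EllTwo)
    rw [hu, pencil, smul_sub, smul_inv_smul₀ hz]
  rw [Function.comp_apply, entryCLM_apply, hp, ← hu, Ring.inverse_unit, Ring.inverse_unit]
  rfl

/-- Since (zB - A)B⁻¹ = z - AB⁻¹, any point of the nonempty spectrum of AB⁻¹ will do. -/
theorem exists_not_isUnit_pencil (hB : IsUnit B) : ∃ z, ¬ IsUnit (pencil A B z) := by
  have : Nontrivial EllTwo := ⟨basisVec 0, 0, fun h => by
    have := congrArg (fun v : EllTwo => v 0) h
    simp [basisVec] at this⟩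
  obtain ⟨b, rfl⟩ := hB
  obtain ⟨z, hz⟩ := spectrum.nonempty (A * (↑b⁻¹ : EllTwo →L[ℂ] EllTwo))
  refine ⟨z, fun hu => hz ?_⟩
  have : algebraMap ℂ (EllTwo →L[ℂ] EllTwo) z - A * (↑b⁻¹ : EllTwo →L[ℂ] EllTwo) =
      pencil A b z * (↑b⁻¹ : EllTwo →L[ℂ] EllTwo) := by
    rw [pencil, sub_mul, smul_mul_assoc, Units.mul_inv, Algebra.algebraMap_eq_smul_one]
  rw [spectrum.mem_resolventSet_iff, this]
  exact hu.mul (b⁻¹).isUnit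

theorem coe_mem_resolventSet : (z : OnePoint ℂ) ∈ resolventSet A B ↔ IsUnit (pencil A B z) := by
  simp [resolventSet]

theorem infty_mem_resolventSet : OnePoint.infty ∈ resolventSet A B ↔ IsUnit B := by
  simp [resolventSet]

theorem IsULFactorization.entry_eq {d uL uR : ℕ → ℂ} (h : IsULFactorization A B z d uL uR)
    (i j : ℕ) : entry (pencil A B z) i j =
      d i * lowerBidiagonal uL i j - uR i * d (i + 1) * lowerBidiagonal uL (i + 1) j := by
  rw [h i j, finsum_eq_sum_of_support_subset (s := {i, i + 1}) _ fun k hk => ?_,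
    Finset.sum_pair (by simp)]
  · simp [upperBidiagonal]; ring
  · by_contra hk'
    simp only [Finset.coe_insert, Finset.coe_singleton, mem_insert_iff, mem_singleton_iff,
      not_or] at hk'
    refine hk ?_
    simp [upperBidiagonal, hk'.2, Ne.symm hk'.1]

end Operator

theorem eval_ne_zero_of_sphereRoot_ne {a b z : ℂ} (h0 : -(C a * X - C b) ≠ (0 : ℂ[X]))
    (h : sphereRoot (-(C a * X - C b)) ≠ z) : (-(C a * X - C b)).eval z ≠ 0 := by
  intro he
  simp only [sphereRoot, coeff_neg, coeff_sub, coeff_C_mul, coeff_X_one, coeff_C_succ,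
    coeff_X_zero, coeff_C_zero] at h
  simp only [eval_neg, eval_sub, eval_mul, eval_C, eval_X] at he
  by_cases ha : a = 0
  · subst ha
    refine h0 ?_
    have : b = 0 := by linear_combination he
    simp [this]
  · rw [if_neg (by simpa using ha)] at h
    refine h (congrArg _ ?_)
    field_simp
    linear_combination he

/-! ### The two sides of the curve and the value of the functional. -/

namespace IsAdmissibleDomain

variable {A B : EllTwo →L[ℂ] EllTwo} {G : Set (OnePoint ℂ)} {γ : ℝ → ℂ}

theorem continuousOn (h : IsAdmissibleDomain A B G γ) : ContinuousOn γ (Icc 0 1) :=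
  h.jordan.lipschitz.choose_spec.continuousOn

theorem intervalIntegrable_deriv (h : IsAdmissibleDomain A B G γ) :
    IntervalIntegrable (deriv γ) volume 0 1 := by
  obtain ⟨K, hK⟩ := h.jordan.lipschitz
  -- The Lipschitz bound controls `deriv γ` only in the open interval; at the endpoints the
  -- derivative also sees γ outside [0, 1].
  rw [intervalIntegrable_iff_integrableOn_Ioo_of_le zero_le_one]
  refine Measure.integrableOn_of_bounded (M := K) (by simp)
    (measurable_deriv γ).aestronglyMeasurable ?_
  refine (ae_restrict_iff' measurableSet_Ioo).2 (Eventually.of_forall fun t ht => ?_)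
  exact norm_deriv_le_of_lipschitzOn (Icc_mem_nhds ht.1 ht.2) hK

theorem coe_mem_frontier (h : IsAdmissibleDomain A B G γ) {z : ℂ} :
    (z : OnePoint ℂ) ∈ frontier G ↔ z ∈ trace γ := by
  rw [h.frontier_eq]
  exact OnePoint.coe_injective.mem_set_image

theorem notMem_of_mem_trace (h : IsAdmissibleDomain A B G γ) {z : ℂ} (hz : z ∈ trace γ) :
    (z : OnePoint ℂ) ∉ G := fun hG =>
  (h.isOpen.frontier_eq ▸ h.coe_mem_frontier.2 hz).2 hG

theorem mem_closure_of_mem_trace (h : IsAdmissibleDomain A B G γ) {z : ℂ} (hz : z ∈ trace γ) :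
    (z : OnePoint ℂ) ∈ closure G :=
  frontier_subset_closure (h.coe_mem_frontier.2 hz)

theorem mem_trace_of_mem_closure (h : IsAdmissibleDomain A B G γ) {z : ℂ}
    (hz : (z : OnePoint ℂ) ∈ closure G) (hG : (z : OnePoint ℂ) ∉ G) : z ∈ trace γ :=
  h.coe_mem_frontier.1 (h.isOpen.frontier_eq ▸ ⟨hz, hG⟩)

theorem infty_notMem_closure (h : IsAdmissibleDomain A B G γ) (hG : OnePoint.infty ∉ G) :
    OnePoint.infty ∉ closure G := fun hc => by
  have : OnePoint.infty ∈ frontier G := h.isOpen.frontier_eq ▸ ⟨hc, hG⟩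
  rw [h.frontier_eq] at this
  exact OnePoint.infty_notMem_image_coe this

theorem isUnit_pencil (h : IsAdmissibleDomain A B G γ) {z : ℂ}
    (hz : (z : OnePoint ℂ) ∈ closure G) : IsUnit (pencil A B z) :=
  coe_mem_resolventSet.1 (h.closure_subset hz)

/-- The orientation hypothesis is vacuous unless the other side of the curve is nonempty. Otherwise
the closure of G would be the whole sphere by density, B would be invertible, and no z could make zB
- A singular. -/
theorem exists_notMem_closure (h : IsAdmissibleDomain A B G γ) :
    ∃ w : ℂ, (w : OnePoint ℂ) ∉ closure G := by
  by_contra! hc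
  have hd : DenseRange ((↑) : ℂ → OnePoint ℂ) := OnePoint.denseRange_coe
  have hu : closure G = univ := eq_univ_of_univ_subset
    (hd.closure_range ▸ closure_minimal (range_subset_iff.2 hc) isClosed_closure)
  obtain ⟨z, hz⟩ := exists_not_isUnit_pencil (A := A)
    (infty_mem_resolventSet.1 (h.closure_subset (hu ▸ mem_univ _)))
  exact hz (h.isUnit_pencil (hc z))

theorem alphaL_eval_ne_zero (h : IsAdmissibleDomain A B G γ) (hAB : IsTridiagonalPencil A B)
    {z : ℂ} (hz : (z : OnePoint ℂ) ∉ G) (n : ℕ) : (alphaL A B n).eval z ≠ 0 :=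
  eval_ne_zero_of_sphereRoot_ne (hAB.alphaL_ne_zero n) fun he => hz (he ▸ h.rootL_mem n)

theorem alphaR_eval_ne_zero (h : IsAdmissibleDomain A B G γ) (hAB : IsTridiagonalPencil A B)
    {z : ℂ} (hz : (z : OnePoint ℂ) ∉ G) (n : ℕ) : (alphaR A B n).eval z ≠ 0 :=
  eval_ne_zero_of_sphereRoot_ne (hAB.alphaR_ne_zero n) fun he => hz (he ▸ h.rootR_mem n)

theorem coeff_ne_zero {p : ℂ[X]} (hG : OnePoint.infty ∉ G) (hp : sphereRoot p ∈ G) :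
    p.coeff 1 ≠ 0 := fun h0 => hG (by rwa [sphereRoot, if_pos h0] at hp)

theorem tendsto_coe_cocompact : Tendsto ((↑) : ℂ → OnePoint ℂ) (cocompact ℂ) (𝓝 OnePoint.infty) :=
  coclosedCompact_eq_cocompact (X := ℂ) ▸ OnePoint.tendsto_coe_infty

/-- Cauchy's formula for the two sides of the curve. -/
theorem cauchy (h : IsAdmissibleDomain A B G γ) {x₀ : ℂ} (hx₀ : (x₀ : OnePoint ℂ) ∈ G)
    {f₁ f₂ : ℂ → ℂ} (hf₁ : ∀ z : ℂ, (z : OnePoint ℂ) ∈ closure G → AnalyticAt ℂ f₁ z)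
    (hl₁ : OnePoint.infty ∈ G → Tendsto f₁ (cocompact ℂ) (𝓝 0))
    (hf₂ : ∀ z : ℂ, (z : OnePoint ℂ) ∉ G → AnalyticAt ℂ f₂ z)
    (hl₂ : OnePoint.infty ∉ G → Tendsto f₂ (cocompact ℂ) (𝓝 0)) :
    contourIntegral γ (fun ζ => (f₁ ζ + f₂ ζ) * (ζ - x₀)⁻¹) =
      -(2 * Real.pi * Complex.I * f₁ x₀) := by
  obtain ⟨w₀, hw₀⟩ := h.exists_notMem_closure
  set E : Set ℂ := {z | (z : OnePoint ℂ) ∈ G}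
  set F : Set ℂ := {z | (z : OnePoint ℂ) ∉ closure G}
  set a := windingNumber γ x₀ with ha
  have hE : IsOpen E := h.isOpen.preimage OnePoint.continuous_coe
  have hF : IsOpen F := isClosed_closure.isOpen_compl.preimage OnePoint.continuous_coe
  have hF' : ∀ z ∈ F, windingNumber γ z = a + 1 := fun z hz => h.liesOnRight x₀ z hx₀ hz
  -- Constancy on each side follows from comparison with one fixed point of the other side.
  have hE' : ∀ z ∈ E, windingNumber γ z = a := fun z hz => by
    have := h.liesOnRight z w₀ hz hw₀
    rw [hF' w₀ hw₀] at this
    exact (add_right_cancel this).symm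
  have hEγ : Disjoint E (trace γ) :=
    Set.disjoint_left.2 fun z hz hz' => h.notMem_of_mem_trace hz' hz
  have hFγ : Disjoint F (trace γ) :=
    Set.disjoint_left.2 fun z hz hz' => hz (h.mem_closure_of_mem_trace hz')
  have hcov : ∀ z, z ∈ E ∨ z ∈ F ∨ z ∈ trace γ := fun z => by
    by_cases h1 : z ∈ E
    · exact Or.inl h1
    · by_cases h2 : z ∈ F
      · exact Or.inr (Or.inl h2)
      · exact Or.inr (Or.inr (h.mem_trace_of_mem_closure (not_not.1 h2) h1))
  have hx₀F : x₀ ∉ F := fun hx => hx (subset_closure hx₀)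
  have hne : ContinuousOn (fun ζ : ℂ => (ζ - x₀)⁻¹) (trace γ) :=
    (continuousOn_id.sub continuousOn_const).inv₀ fun ζ hζ =>
      sub_ne_zero.2 (ne_of_mem_of_not_mem hζ fun hx => h.notMem_of_mem_trace hx hx₀)
  -- If ∞ is not in G it is not in its closure either, so E is bounded and the filter is trivial.
  have lim₁ : Tendsto f₁ (cocompact ℂ ⊓ 𝓟 E) (𝓝 0) := by
    by_cases hG : OnePoint.infty ∈ G
    · exact (hl₁ hG).mono_left inf_le_left
    · have hmem : F ∈ cocompact ℂ := tendsto_coe_cocompact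
        (isClosed_closure.isOpen_compl.mem_nhds (h.infty_notMem_closure hG))
      refine Tendsto.mono_left tendsto_bot (le_of_eq ?_)
      rw [← disjoint_iff, disjoint_principal_right]
      exact mem_of_superset hmem fun z hz hzE => hz (subset_closure hzE)
  have lim₂ : Tendsto f₂ (cocompact ℂ ⊓ 𝓟 F) (𝓝 0) := by
    by_cases hG : OnePoint.infty ∈ G
    · have hmem : E ∈ cocompact ℂ := tendsto_coe_cocompact (h.isOpen.mem_nhds hG)
      refine Tendsto.mono_left tendsto_bot (le_of_eq ?_)
      rw [← disjoint_iff, disjoint_principal_right]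
      exact mem_of_superset hmem fun z hz hzF => hzF (subset_closure hz)
    · exact (hl₂ hG).mono_left inf_le_left
  -- For f₁ the point x₀ is on the side of analyticity, with factor a - (a + 1) = -1. For f₂ the
  -- roles of E and F are exchanged, and the integral vanishes.
  have h₁ := (cauchy_formula h.continuousOn h.intervalIntegrable_deriv hF hEγ hFγ hcov hE' hF'
    (fun z hz => hf₁ z (not_not.1 hz)) lim₁).2 x₀ hx₀ hx₀F
  have h₂ := (cauchy_formula h.continuousOn h.intervalIntegrable_deriv hE hFγ hEγ
    (fun z => by have := hcov z; tauto) hF' hE' (fun z hz => hf₂ z hz) lim₂).1 x₀ hx₀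
  have hc₁ : ContinuousOn f₁ (trace γ) := fun ζ hζ =>
    (hf₁ ζ (h.mem_closure_of_mem_trace hζ)).continuousAt.continuousWithinAt
  have hc₂ : ContinuousOn f₂ (trace γ) := fun ζ hζ =>
    (hf₂ ζ (h.notMem_of_mem_trace hζ)).continuousAt.continuousWithinAt
  simp only [add_mul]
  rw [contourIntegral_add (f := fun ζ => f₁ ζ * (ζ - x₀)⁻¹) (g := fun ζ => f₂ ζ * (ζ - x₀)⁻¹)
    h.continuousOn h.intervalIntegrable_deriv (hc₁.mul hne) (hc₂.mul hne), h₁, h₂]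
  ring

theorem continuousOn_mFun (h : IsAdmissibleDomain A B G γ) :
    ContinuousOn (mFun A B) (trace γ) := fun _ hζ =>
  (analyticAt_resolvent (h.isUnit_pencil (h.mem_closure_of_mem_trace hζ)) 0
    0).continuousAt.continuousWithinAt

theorem continuousOn_geronimusL (h : IsAdmissibleDomain A B G γ) (hAB : IsTridiagonalPencil A B)
    (u : ℕ → ℂ) (n : ℕ) : ContinuousOn (geronimusL A B u n) (trace γ) := by
  have hq : ∀ n, ContinuousOn (qL A B n) (trace γ) := fun n =>
    (q A B n).continuousOn.div (continuousOn_finsetProd _ fun k _ => (alphaL A B k).continuousOn)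
      fun ζ hζ => Finset.prod_ne_zero_iff.2 fun k _ =>
        h.alphaL_eval_ne_zero hAB (h.notMem_of_mem_trace hζ) k
  cases n with
  | zero => exact continuousOn_const
  | succ n => exact (hq _).sub (continuousOn_const.mul (hq n))

theorem continuousOn_geronimusR (h : IsAdmissibleDomain A B G γ) (hAB : IsTridiagonalPencil A B)
    (u : ℕ → ℂ) (n : ℕ) : ContinuousOn (geronimusR A B u n) (trace γ) := by
  have hq : ∀ n, ContinuousOn (qR A B n) (trace γ) := fun n =>
    (q A B n).continuousOn.div (continuousOn_finsetProd _ fun k _ => (alphaR A B k).continuousOn)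
      fun ζ hζ => Finset.prod_ne_zero_iff.2 fun k _ =>
        h.alphaR_eval_ne_zero hAB (h.notMem_of_mem_trace hζ) k
  cases n with
  | zero => exact continuousOn_const
  | succ n => exact (hq _).sub (continuousOn_const.mul (hq n))

/-- The functional, applied to a product of Geronimus transforms, only sees the rational part. -/
theorem geronimusFunctional_eq (h : IsAdmissibleDomain A B G γ) (hAB : IsTridiagonalPencil A B)
    {x₀ : ℂ} (hx₀ : (x₀ : OnePoint ℂ) ∈ G) (hL : ∀ n, (alphaL A B n).eval x₀ ≠ 0)
    (hR : ∀ n, (alphaR A B n).eval x₀ ≠ 0) (d₀ : ℂ) (uL uR : ℕ → ℂ) (j k : ℕ) :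
    geronimusFunctional A B γ x₀ d₀ (fun x => geronimusR A B uL j x * geronimusL A B uR k x) =
      geronimusR A B uL j x₀ * geronimusL A B uR k x₀ / d₀ -
        dressed uL uR (rationalPart A B x₀) j k := by
  set f₁ : ℂ → ℂ := fun z =>
    dressed uL uR (fun i l => entry (Ring.inverse (pencil A B z)) i l) j k
  set f₂ : ℂ → ℂ := fun z => dressed uL uR (rationalPart A B z) j k
  have hsum : ∀ z, IsUnit (pencil A B z) → (∀ n, (alphaL A B n).eval z ≠ 0) →
      (∀ n, (alphaR A B n).eval z ≠ 0) →
      geronimusR A B uL j z * geronimusL A B uR k z * mFun A B z = f₁ z + f₂ z := by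
    intro z hz hzL hzR
    rw [geronimusR_eq, geronimusL_eq, ← dressed_mul, ← dressed_add]
    simp only [resolvent_add_rationalPart hAB hz hzL hzR]
  have hc := h.cauchy (f₁ := f₁) (f₂ := f₂) hx₀
    (fun z hz => AnalyticAt.dressed (fun i l => analyticAt_resolvent (h.isUnit_pencil hz) i l) j k)
    (fun hG => Tendsto.dressed (fun i l => tendsto_resolvent
      (infty_mem_resolventSet.1 (h.closure_subset (subset_closure hG))) i l) j k)
    (fun z hz => AnalyticAt.dressed (fun i l => analyticAt_rationalPart
      (h.alphaL_eval_ne_zero hAB hz) (h.alphaR_eval_ne_zero hAB hz) i l) j k)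
    (fun hG => Tendsto.dressed (fun i l => tendsto_rationalPart
      (fun n => coeff_ne_zero hG (h.rootL_mem n)) (fun n => coeff_ne_zero hG (h.rootR_mem n))
        i l) j k)
  have hint : contourIntegral γ (fun ζ => geronimusR A B uL j ζ * geronimusL A B uR k ζ *
      (mFun A B ζ / (x₀ - ζ))) = 2 * Real.pi * Complex.I * f₁ x₀ := by
    -- The sign of 1/(x₀ - ζ) = -1/(ζ - x₀) offsets the minus sign due to the orientation.
    rw [contourIntegral_congr (g := fun ζ => -1 * ((f₁ ζ + f₂ ζ) * (ζ - x₀)⁻¹)) fun ζ hζ => ?_,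
      contourIntegral_const_mul, hc]
    · ring
    · have hζG := h.notMem_of_mem_trace hζ
      rw [← hsum ζ (h.isUnit_pencil (h.mem_closure_of_mem_trace hζ))
        (h.alphaL_eval_ne_zero hAB hζG) (h.alphaR_eval_ne_zero hAB hζG), ← neg_sub ζ x₀,
        div_eq_mul_inv, inv_neg]
      ring
  -- As x₀ lies in G, where the roots of the α's are, the nonvanishing of the α's at x₀ has to be
  -- assumed separately here.
  have hx := hsum x₀ (h.isUnit_pencil (subset_closure hx₀)) hL hR
  rw [geronimusFunctional, hint, inv_mul_cancel_left₀ Complex.two_pi_I_ne_zero]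
  change _ = _ - f₂ x₀
  linear_combination -hx

end IsAdmissibleDomain

end Operators

end LinearPencil

end

theorem proposition4p2
    (A B : LinearPencil.EllTwo →L[ℂ] LinearPencil.EllTwo)
    (hAB : LinearPencil.IsTridiagonalPencil A B)
    (G : Set (OnePoint ℂ)) (γ : ℝ → ℂ)
    (hG : LinearPencil.IsAdmissibleDomain A B G γ)
    (x₀ : ℂ) (hx₀ : (x₀ : OnePoint ℂ) ∈ G)
    (hα : ∀ n, (LinearPencil.alphaL A B n).eval x₀ ≠ 0 ∧
      (LinearPencil.alphaR A B n).eval x₀ ≠ 0)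
    (d uL uR : ℕ → ℂ)
    (hUL : LinearPencil.IsULFactorization A B x₀ d uL uR)
    (hd₀ : d 0 ≠ 0) :
    (∀ g : ℂ → ℂ, ContinuousOn g (LinearPencil.trace γ) →
      IntervalIntegrable
        (fun t => g (γ t) * (LinearPencil.mFun A B (γ t) / (x₀ - γ t)) * deriv γ t)
        MeasureTheory.volume 0 1) ∧
    (∀ j k, ContinuousOn
      (fun x => LinearPencil.geronimusR A B uL j x * LinearPencil.geronimusL A B uR k x)
      (LinearPencil.trace γ)) ∧
    (∀ j k, j ≠ k →
      LinearPencil.geronimusFunctional A B γ x₀ (d 0)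
        (fun x => LinearPencil.geronimusR A B uL j x *
          LinearPencil.geronimusL A B uR k x) = 0) ∧
    (∀ j, d j ≠ 0 ∧
      LinearPencil.geronimusFunctional A B γ x₀ (d 0)
        (fun x => LinearPencil.geronimusR A B uL j x *
          LinearPencil.geronimusL A B uR j x) = 1 / d j) := by
  have hd := hUL.entry_eq
  have hβ : ∀ n, (LinearPencil.beta A B n).eval x₀ = d n + uR n * uL n * d (n + 1) := fun n => by
    rw [LinearPencil.beta_eval, hd]
    simp [LinearPencil.lowerBidiagonal]; ring
  have hdL : ∀ n, (LinearPencil.alphaL A B n).eval x₀ = uL n * d (n + 1) := fun n => by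
    rw [LinearPencil.alphaL_eval, hd]
    simp [LinearPencil.lowerBidiagonal, show n + 1 + 1 ≠ n by omega, mul_comm]
  have hdR : ∀ n, (LinearPencil.alphaR A B n).eval x₀ = uR n * d (n + 1) := fun n => by
    rw [LinearPencil.alphaR_eval, hd]
    simp [LinearPencil.lowerBidiagonal, show n ≠ n + 1 + 1 by omega]
  have hL := fun n => (hα n).1
  have hR := fun n => (hα n).2
  -- Beyond d₀, each d_{n+1} is a factor of the nonzero number α_n^L(x₀).
  have hne : ∀ n, d n ≠ 0 := fun n => by
    cases n with
    | zero => exact hd₀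
    | succ n => exact right_ne_zero_of_mul (hdL n ▸ hL n)
  have hS : ∀ j k, _ := fun j k =>
    (hG.geronimusFunctional_eq hAB hx₀ hL hR (d 0) uL uR j k).trans
      (LinearPencil.geronimus_mul_div_sub_dressed_rationalPart hL hR hβ hdL hdR hne j k)
  refine ⟨fun g hg => ?_, fun j k => ?_, fun j k hjk => ?_, fun j => ⟨hne j, ?_⟩⟩
  · refine LinearPencil.intervalIntegrable_contour
      (f := fun ζ => g ζ * (LinearPencil.mFun A B ζ / (x₀ - ζ))) hG.continuousOn
      hG.intervalIntegrable_deriv (hg.mul (hG.continuousOn_mFun.div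
        (continuousOn_const.sub continuousOn_id) fun ζ hζ => sub_ne_zero.2 ?_))
    rintro rfl
    exact hG.notMem_of_mem_trace hζ hx₀
  · exact (hG.continuousOn_geronimusR hAB uL j).mul (hG.continuousOn_geronimusL hAB uR k)
  · rw [hS, if_neg hjk]
  · rw [hS, if_pos rfl]
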